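/- A \emph{continuum} is a nonempty compact connected metric space. For a continuum $X$ let $2^X$ be the space of nonempty closed subsets of $X$ with the Hausdorff metric, and let $C(X)\subset 2^X$ be the subspace of subcontinua (nonempty compact connected subsets) of $X$. A subcontinuum $K$ of $X$ is \emph{terminal} if every subcontinuum $L$ of $X$ with $K\cap L\neq\emptyset$ satisfies $K\subset L$ or $L\subset K$; it is \emph{filament} if there is an open set $U\supset K$ such that the component of $U$ containing $K$ has empty interior; it is \emph{ample} if for every open $U\supset K$ there is $L\in C(X)$ with $K\subset\operatorname{int}(L)\subset L\subset U$. Let $\mathcal F$ and $\mathcal A$ be the sets of filament and of ample subcontinua of $X$. The \emph{Planck boundary} of $C(X)$ is $\mathcal P=\mathcal A\cap\overline{\mathcal F}$, the closure being taken in $C(X)$. A \emph{pseudo-arc} is a nondegenerate hereditarily indecomposable chainable continuum. A \emph{Whitney map} is a continuous $\mu:2^X\to[0,\infty)$ such that $\mu(\{x\})=0$ for all $x\in X$; $\mu(A)<\mu(B)$ whenever $A\subsetneq B$; and $\mu(A\cup B)\le\mu(A)+\mu(B)-\mu(A\cap B)$ whenever $A\cap B\ne\emptyset$. Write $\mu_C=\mu|_{C(X)}$.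 \textbf{Corollary.} Let $\Psi_0$ be a circle of pseudo-arcs, that is, a continuum with a continuous open surjection $\Pi:\Psi_0\to S^1$ all of whose fibers $P_\alpha=\Pi^{-1}(e^{i\alpha})$, $\alpha\in[0,2\pi)$, are pseudo-arcs and terminal subcontinua of $\Psi_0$. Let $\mu:2^{\Psi_0}\to[0,\infty)$ be a Whitney map and suppose that there is a constant $l$ (the Planck constant of $\Psi_0$) with $\mu_C(P_\alpha)=l$ for all $\alpha\in[0,2\pi)$. Then the Planck boundary of $C(\Psi_0)$ is the Whitney level set defined by $l$: $$\mathcal P=\mu_C^{-1}(l).$$ -/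

import Mathlib

open TopologicalSpace

/-- The hyperspace `C(X)` of subcontinua of `X` (nonempty compact connected subsets).
`NonemptyCompacts X` is the hyperspace `2^X` with the Hausdorff metric, and `C(X)` carries the
induced metric. -/
abbrev Hyperspace (X : Type*) [MetricSpace X] : Type _ :=
  {K : NonemptyCompacts X // IsConnected (K : Set X)}

namespace Hyperspace

variable {X : Type*} [MetricSpace X]

/-- The underlying subset of a subcontinuum. -/
def carrier (K : Hyperspace X) : Set X := (K.1 : Set X)

/-- `K` is decomposable: it is the union of two proper subcontinua. -/
def Decomposable (K : Hyperspace X) : Prop :=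
  ∃ A B : Hyperspace X,
    A.carrier ≠ K.carrier ∧ B.carrier ≠ K.carrier ∧ A.carrier ∪ B.carrier = K.carrier

/-- `K` is terminal in `X`: every subcontinuum meeting `K` contains `K` or is contained in `K`. -/
def Terminal (K : Hyperspace X) : Prop :=
  ∀ L : Hyperspace X, (K.carrier ∩ L.carrier).Nonempty →
    K.carrier ⊆ L.carrier ∨ L.carrier ⊆ K.carrier

/-- `K` is filament: some open `U ⊇ K` is such that the component of `U` containing `K` has empty
interior. -/
def Filament (K : Hyperspace X) : Prop :=
  ∃ U : Set X, IsOpen U ∧ K.carrier ⊆ U ∧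
    ∀ x ∈ K.carrier, interior (connectedComponentIn U x) = ∅

/-- `K` is ample: each open `U ⊇ K` contains a subcontinuum whose interior contains `K`. -/
def Ample (K : Hyperspace X) : Prop :=
  ∀ U : Set X, IsOpen U → K.carrier ⊆ U →
    ∃ L : Hyperspace X, K.carrier ⊆ interior L.carrier ∧ L.carrier ⊆ U

end Hyperspace

/-- The filament portion of `C(X)`. -/
def filamentPortion (X : Type*) [MetricSpace X] : Set (Hyperspace X) := {K | K.Filament}

/-- The ample portion of `C(X)`. -/
def amplePortion (X : Type*) [MetricSpace X] : Set (Hyperspace X) := {K | K.Ample}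

/-- The Planck boundary: the ample elements in the closure of the filament portion, the closure
being taken in `C(X)`. -/
def planckBoundary (X : Type*) [MetricSpace X] : Set (Hyperspace X) :=
  amplePortion X ∩ closure (filamentPortion X)

/-- `X` is chainable: for each `ε > 0` it has a finite open cover `C₁, …, Cₙ` by sets of diameter
less than `ε` with `C_k ∩ C_l ≠ ∅` if and only if `|k - l| ≤ 1`. -/
def Chainable (X : Type*) [MetricSpace X] : Prop :=
  ∀ ε : ℝ, 0 < ε → ∃ (n : ℕ) (C : Fin n → Set X),
    (∀ k, IsOpen (C k)) ∧ (⋃ k, C k) = Set.univ ∧ (∀ k, Metric.diam (C k) < ε) ∧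
      ∀ k l : Fin n, (C k ∩ C l).Nonempty ↔ |((k : ℕ) : ℤ) - ((l : ℕ) : ℤ)| ≤ 1

/-- `X` is a pseudo-arc: a nondegenerate, chainable, hereditarily indecomposable continuum. -/
structure IsPseudoArc (X : Type*) [MetricSpace X] : Prop where
  compact : CompactSpace X
  connected : ConnectedSpace X
  nondegenerate : Nontrivial X
  chainable : Chainable X
  hereditarilyIndecomposable : ∀ K : Hyperspace X, ¬ K.Decomposable

/-- `p : X → S¹` exhibits the continuum `X` as a circle of pseudo-arcs: it is an open map (that is,
its fibers form a continuous decomposition of `X`), all of whose fibers are pseudo-arcs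
and terminal subcontinua of `X`. (Surjectivity holds because the fibers are nonempty.) -/
structure IsCircleOfPseudoArcs {X : Type*} [MetricSpace X] (p : X → Circle) : Prop where
  continuous : Continuous p
  isOpenMap : IsOpenMap p
  pseudoArc : ∀ z : Circle, IsPseudoArc (p ⁻¹' {z})
  terminal : ∀ (z : Circle) (K : Hyperspace X), K.carrier = p ⁻¹' {z} → K.Terminal

/-- The pseudo-arc `p⁻¹(z)` of the decomposition, as an element of `C(X)`. -/
def IsCircleOfPseudoArcs.fiber {X : Type*} [MetricSpace X] {p : X → Circle}
    (hp : IsCircleOfPseudoArcs p) (z : Circle) : Hyperspace X :=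
  ⟨⟨⟨p ⁻¹' {z}, isCompact_iff_compactSpace.mpr (hp.pseudoArc z).compact⟩,
      (isConnected_iff_connectedSpace.mpr (hp.pseudoArc z).connected).nonempty⟩,
    isConnected_iff_connectedSpace.mpr (hp.pseudoArc z).connected⟩

/-- Whitney maps on `2^X`, with the submodularity condition. -/
structure IsWhitneyMap {X : Type*} [MetricSpace X] (μ : NonemptyCompacts X → ℝ) : Prop where
  continuous : Continuous μ
  nonneg : ∀ A, 0 ≤ μ A
  singleton : ∀ (x : X) (A : NonemptyCompacts X), (A : Set X) = {x} → μ A = 0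
  strictMono : ∀ A B : NonemptyCompacts X, (A : Set X) ⊂ (B : Set X) → μ A < μ B
  submodular : ∀ A B I : NonemptyCompacts X, (I : Set X) = (A : Set X) ∩ (B : Set X) →
    μ (A ⊔ B) ≤ μ A + μ B - μ I

/-- The restriction `μ_C` of `μ` from `2^X` to `C(X)`. -/
def whitneyRestrict {X : Type*} [MetricSpace X] (μ : NonemptyCompacts X → ℝ) :
    Hyperspace X → ℝ :=
  fun K => μ K.1

/-!
A terminal proper subcontinuum has empty interior, by boundary bumping, and its proper subcontinua
are filament. Hence each fibre `P y` of the decomposition, being indecomposable and so a limit of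
its proper subcontinua, lies in the closure of the filament continua; it is ample because the
preimages of small closed connected neighbourhoods of `y` are continua. Conversely a filament
continuum lies in some fibre, which is a closed condition, and an ample continuum in a fibre is the
whole fibre.
So the Planck boundary is the set of fibres. By terminality every continuum is comparable with the
fibres it meets, so a strictly monotone function that is constant on the fibres takes that value
nowhere else.
-/

open Set Topology

section Topology

variable {X : Type*} [TopologicalSpace X]

lemma exists_isClopen_mem_subset_of_connectedComponent_subset [T2Space X] [CompactSpace X]
    {x : X} {U : Set X} (hU : IsOpen U) (hxU : connectedComponent x ⊆ U) :
    ∃ Q : Set X, IsClopen Q ∧ x ∈ Q ∧ Q ⊆ U := by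
  rw [connectedComponent_eq_iInter_isClopen] at hxU
  have : Nonempty {Q : Set X // IsClopen Q ∧ x ∈ Q} := ⟨⟨univ, isClopen_univ, mem_univ x⟩⟩
  obtain ⟨⟨Q, hQ, hxQ⟩, hQU⟩ := exists_subset_nhds_of_compactSpace
    (V := fun Q : {Q : Set X // IsClopen Q ∧ x ∈ Q} => (Q : Set X))
    (fun Q R => ⟨⟨Q.1 ∩ R.1, Q.2.1.inter R.2.1, Q.2.2, R.2.2⟩, inter_subset_left,
      inter_subset_right⟩)
    (fun Q => Q.2.1.isClosed) (fun _ hy => hU.mem_nhds (hxU hy))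
  exact ⟨Q, hQ, hxQ, hQU⟩

/-- Boundary bumping: if the component stayed away from `T \ S`, a clopen subset of `S` around it
would also split `T`. -/
theorem connectedComponentIn_inter_closure_diff_nonempty [T2Space X] {S T : Set X}
    (hT : IsPreconnected T) (hS : IsCompact S) (hST : S ⊂ T) {x : X} (hx : x ∈ S) :
    (connectedComponentIn S x ∩ closure (T \ S)).Nonempty := by
  by_contra hdisj
  have : CompactSpace S := isCompact_iff_compactSpace.1 hS
  obtain ⟨Q, hQ, hxQ, hQdisj⟩ : ∃ Q : Set S, IsClopen Q ∧ ⟨x, hx⟩ ∈ Q ∧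
      Q ⊆ Subtype.val ⁻¹' (closure (T \ S))ᶜ := by
    refine exists_isClopen_mem_subset_of_connectedComponent_subset
      (isClosed_closure.isOpen_compl.preimage continuous_subtype_val)
      fun y hy hyT => hdisj ⟨y, ?_, hyT⟩
    rw [connectedComponentIn_eq_image hx]
    exact mem_image_of_mem _ hy
  have isClosed_image {R : Set S} (hR : IsClosed R) : IsClosed (Subtype.val '' R : Set X) :=
    (hR.isCompact.image continuous_subtype_val).isClosed
  have hcover : T ⊆ Subtype.val '' Q ∪ (Subtype.val '' Qᶜ ∪ closure (T \ S)) := by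
    rw [← union_assoc, ← image_union, union_compl_self, image_univ, Subtype.range_coe]
    exact (union_sdiff_cancel hST.subset).ge.trans (union_subset_union_right S subset_closure)
  obtain ⟨v, hvT, hvS⟩ := exists_of_ssubset hST
  obtain ⟨-, -, ⟨q, hqQ, rfl⟩, ⟨q', hq', hqq'⟩ | hq⟩ := isPreconnected_closed_iff.1 hT _ _
    (isClosed_image hQ.isClosed) ((isClosed_image hQ.compl.isClosed).union isClosed_closure) hcover
    ⟨x, hST.subset hx, ⟨x, hx⟩, hxQ, rfl⟩ ⟨v, hvT, Or.inr (subset_closure ⟨hvT, hvS⟩)⟩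
  · exact hq' (Subtype.ext hqq' ▸ hqQ)
  · exact hQdisj hqQ hq

lemma isClosed_connectedComponentIn {S : Set X} (hS : IsClosed S) (x : X) :
    IsClosed (connectedComponentIn S x) := by
  by_cases hx : x ∈ S
  · refine isClosed_of_closure_subset <|
      isPreconnected_connectedComponentIn.closure.subset_connectedComponentIn
        (subset_closure (mem_connectedComponentIn hx))
        (closure_minimal (connectedComponentIn_subset S x) hS)
  · rw [connectedComponentIn_eq_empty hx]
    exact isClosed_empty

lemma interior_nonempty_of_isPreconnected_of_subset_source {α : Type*}
    [ConditionallyCompleteLinearOrder α] [TopologicalSpace α] [OrderTopology α] [DenselyOrdered α]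
    (e : OpenPartialHomeomorph X α)
    {S : Set X} (hSe : S ⊆ e.source) (hS : IsPreconnected S) (hnt : S.Nontrivial) :
    (interior S).Nonempty := by
  have himage : IsPreconnected (e '' S) := hS.image e (e.continuousOn.mono hSe)
  obtain ⟨_, ⟨x, hx, rfl⟩, _, ⟨y, hy, rfl⟩, hxy⟩ :=
    (hnt.image_of_injOn (e.injOn.mono hSe)).exists_lt
  have hIoo : Ioo (e x) (e y) ⊆ e '' S := Ioo_subset_Icc_self.trans
    (himage.Icc_subset (mem_image_of_mem e hx) (mem_image_of_mem e hy))
  have hpreimage : e.source ∩ e ⁻¹' Ioo (e x) (e y) ⊆ S := by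
    rintro u ⟨hu, hue⟩
    obtain ⟨v, hv, hvu⟩ := hIoo hue
    exact e.injOn (hSe hv) hu hvu ▸ hv
  obtain ⟨t, ht⟩ := exists_between hxy
  obtain ⟨z, hz, rfl⟩ := hIoo ht
  exact ⟨z, interior_maximal hpreimage (e.isOpen_inter_preimage isOpen_Ioo) ⟨hSe hz, ht⟩⟩

end Topology

section Circle

instance : Nontrivial Circle := ⟨-1, 1, Circle.neg_ne_self 1⟩

instance : LocallyConnectedSpace Circle :=
  ChartedSpace.locallyConnectedSpace (EuclideanSpace ℝ (Fin 1)) Circle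

lemma exists_openPartialHomeomorph_source_eq_compl_singleton (w : Circle) :
    ∃ e : OpenPartialHomeomorph Circle ℝ, e.source = {w}ᶜ := by
  have : Fact (0 < 2 * Real.pi) := ⟨Real.two_pi_pos⟩
  obtain ⟨a, ha⟩ := QuotientAddGroup.mk_surjective (AddCircle.homeomorphCircle'.symm w)
  refine ⟨AddCircle.homeomorphCircle'.symm.toOpenPartialHomeomorph.trans
    (AddCircle.openPartialHomeomorphCoe (2 * Real.pi) a).symm, ?_⟩
  ext z
  simp [← AddCircle.homeomorphCircle'.symm.injective.ne_iff, ← ha]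

lemma interior_nonempty_of_isPreconnected_circle {S : Set Circle} (hS : IsPreconnected S)
    (hnt : S.Nontrivial) : (interior S).Nonempty := by
  by_cases hne : S = univ
  · rw [hne, interior_univ]
    exact univ_nonempty
  obtain ⟨w, hw⟩ := (ne_univ_iff_exists_notMem S).1 hne
  obtain ⟨e, he⟩ := exists_openPartialHomeomorph_source_eq_compl_singleton w
  exact interior_nonempty_of_isPreconnected_of_subset_source e
    (he ▸ subset_compl_singleton_iff.2 hw) hS hnt

end Circle

namespace Hyperspace

variable {X : Type*} [MetricSpace X] {K T : Hyperspace X}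

/-- The subcontinuum with a given compact connected underlying set. -/
def ofSet (S : Set X) (hS : IsCompact S) (hc : IsConnected S) : Hyperspace X :=
  ⟨⟨⟨S, hS⟩, hc.nonempty⟩, hc⟩

lemma isCompact_carrier (K : Hyperspace X) : IsCompact K.carrier := K.1.isCompact

lemma isConnected_carrier (K : Hyperspace X) : IsConnected K.carrier := K.2

lemma carrier_injective : Function.Injective (carrier : Hyperspace X → Set X) :=
  fun _ _ h => Subtype.ext (NonemptyCompacts.ext h)

lemma exists_le_disjoint_inter_closure_nonempty (T : Hyperspace X) {V : Set X} (hV : IsOpen V)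
    (hVT : (T.carrier ∩ V).Nonempty) {x : X} (hx : x ∈ T.carrier \ V) :
    ∃ K ≤ T, x ∈ K.carrier ∧ Disjoint K.carrier V ∧ (K.carrier ∩ closure V).Nonempty := by
  have hS : IsCompact (T.carrier \ V) := T.isCompact_carrier.diff hV
  obtain ⟨v, hvT, hvV⟩ := hVT
  have hST : T.carrier \ V ⊂ T.carrier :=
    ssubset_of_subset_not_subset sdiff_subset fun h => (h hvT).2 hvV
  have hC := connectedComponentIn_subset (T.carrier \ V) x
  refine ⟨ofSet (connectedComponentIn (T.carrier \ V) x)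
    (hS.of_isClosed_subset (isClosed_connectedComponentIn hS.isClosed x) hC)
    (isConnected_connectedComponentIn_iff.2 hx), hC.trans sdiff_subset,
    mem_connectedComponentIn hx, disjoint_sdiff_left.mono_left hC, ?_⟩
  refine (connectedComponentIn_inter_closure_diff_nonempty
    T.isConnected_carrier.isPreconnected hS hST hx).mono (inter_subset_inter_right _ ?_)
  rw [sdiff_sdiff_right_self]
  exact closure_mono inter_subset_right

lemma exists_lt_mem_inter_nonempty (hT : T.carrier.Nontrivial) {x : X} (hx : x ∈ T.carrier)
    {U : Set X} (hU : IsOpen U) (hUT : (T.carrier ∩ U).Nonempty) :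
    ∃ K < T, x ∈ K.carrier ∧ (K.carrier ∩ U).Nonempty := by
  by_cases hxU : x ∈ U
  · obtain ⟨y, hy, hyx⟩ := hT.exists_ne x
    exact ⟨ofSet {x} isCompact_singleton isConnected_singleton,
      lt_of_le_not_ge (singleton_subset_iff.2 hx) fun h => hyx (h hy),
      rfl, x, rfl, hxU⟩
  · obtain ⟨c, hcT, hcU⟩ := hUT
    obtain ⟨V, hV, hcV, hVU⟩ := normal_exists_closure_subset isClosed_singleton hU
      (singleton_subset_iff.2 hcU)
    obtain ⟨K, hKT, hxK, hKV, hK⟩ := T.exists_le_disjoint_inter_closure_nonempty hV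
      ⟨c, hcT, hcV rfl⟩ ⟨hx, fun h => hxU (hVU (subset_closure h))⟩
    exact ⟨K, lt_of_le_not_ge hKT fun h => disjoint_left.1 hKV (h hcT) (hcV rfl),
      hxK, hK.mono (inter_subset_inter_right _ hVU)⟩

lemma directedOn_lt_and_mem_carrier (hT : ¬ T.Decomposable) (x : X) :
    DirectedOn (· ≤ ·) {K : Hyperspace X | K < T ∧ x ∈ K.carrier} := by
  rintro K ⟨hKT, hxK⟩ L ⟨hLT, hxL⟩
  refine ⟨ofSet (K.carrier ∪ L.carrier) (K.isCompact_carrier.union L.isCompact_carrier)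
    (K.isConnected_carrier.union ⟨x, hxK, hxL⟩ L.isConnected_carrier),
    ⟨?_, Or.inl hxK⟩, subset_union_left, subset_union_right⟩
  exact (union_subset hKT.le hLT.le).ssubset_of_ne fun h =>
    hT ⟨K, L, (ne_of_lt hKT <| carrier_injective ·), (ne_of_lt hLT <| carrier_injective ·), h⟩

/-- The proper subcontinua through a fixed point of `T` are dense in `T` and, as `T` is
indecomposable, directed; so one of them meets any finitely many open sets that meet `T`. -/
theorem mem_closure_Iio (hnt : T.carrier.Nontrivial) (hT : ¬ T.Decomposable) :
    T ∈ closure (Iio T) := by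
  obtain ⟨x, hx⟩ := hnt.nonempty
  have hbasis := NonemptyCompacts.isTopologicalBasis.isInducing
    (IsInducing.subtypeVal (t := {K : NonemptyCompacts X | IsConnected (K : Set X)}))
  rw [hbasis.mem_closure_iff]
  rintro _ ⟨_, ⟨u, ⟨hu, ⟨U₀, hU₀⟩, huo⟩, rfl⟩, rfl⟩ ⟨hTu, hTU⟩
  have hmeet (U : u) : ∃ K : {K : Hyperspace X | K < T ∧ x ∈ K.carrier},
      (K.1.carrier ∩ U).Nonempty := by
    obtain ⟨K, hKT, hxK, hKU⟩ := exists_lt_mem_inter_nonempty hnt hx (huo U U.2) (hTU U U.2)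
    exact ⟨⟨K, hKT, hxK⟩, hKU⟩
  choose K hKU using hmeet
  have : Nonempty {K : Hyperspace X | K < T ∧ x ∈ K.carrier} := ⟨K ⟨U₀, hU₀⟩⟩
  have := hu.to_subtype
  obtain ⟨⟨L, hLT, _⟩, hL⟩ := (directedOn_lt_and_mem_carrier hT x).directed_val.finite_le K
  have hLU (U : Set X) (hU : U ∈ u) : (L.carrier ∩ U).Nonempty :=
    (hKU ⟨U, hU⟩).mono (inter_subset_inter_left U (hL ⟨U, hU⟩))
  exact ⟨L, ⟨(show L.carrier ⊆ T.carrier from hLT.le).trans hTu, hLU⟩, hLT⟩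

section Restrict

variable {S : Set X}

/-- A subcontinuum of `X` lying in `S`, viewed as a subcontinuum of the subspace `S`. -/
def restrict (K : Hyperspace X) (hKS : K.carrier ⊆ S) : Hyperspace S :=
  ofSet (Subtype.val ⁻¹' K.carrier)
    (IsInducing.subtypeVal.isCompact_preimage' K.isCompact_carrier (by simpa using hKS))
    (by
      have himage := Subtype.image_preimage_coe S K.carrier |>.trans (inter_eq_right.2 hKS)
      refine ⟨image_nonempty.1 (himage ▸ K.isConnected_carrier.nonempty), ?_⟩
      rw [← IsInducing.subtypeVal.isPreconnected_image, himage]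
      exact K.isConnected_carrier.isPreconnected)

lemma image_val_carrier_restrict (hKS : K.carrier ⊆ S) :
    Subtype.val '' (K.restrict hKS).carrier = K.carrier :=
  Subtype.image_preimage_coe S K.carrier |>.trans (inter_eq_right.2 hKS)

lemma Decomposable.restrict (hK : K.Decomposable) (hKS : K.carrier ⊆ S) :
    (K.restrict hKS).Decomposable := by
  obtain ⟨A, B, hA, hB, hAB⟩ := hK
  have hAS : A.carrier ⊆ S := (subset_union_left.trans hAB.le).trans hKS
  have hBS : B.carrier ⊆ S := (subset_union_right.trans hAB.le).trans hKS
  refine ⟨A.restrict hAS, B.restrict hBS, fun h => hA ?_, fun h => hB ?_, ?_⟩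
  · rw [← image_val_carrier_restrict hAS, h, image_val_carrier_restrict]
  · rw [← image_val_carrier_restrict hBS, h, image_val_carrier_restrict]
  · exact congrArg (Subtype.val ⁻¹' ·) hAB

end Restrict

lemma Filament.exists_isOpen_forall_interior_eq_empty (hK : K.Filament) :
    ∃ U : Set X, IsOpen U ∧ K.carrier ⊆ U ∧
      ∀ L, K ≤ L → L.carrier ⊆ U → interior L.carrier = ∅ := by
  obtain ⟨U, hU, hKU, hint⟩ := hK
  obtain ⟨x, hx⟩ := K.isConnected_carrier.nonempty
  refine ⟨U, hU, hKU, fun L hKL hLU => subset_eq_empty (interior_mono ?_) (hint x hx)⟩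
  exact L.isConnected_carrier.isPreconnected.subset_connectedComponentIn (hKL hx) hLU

lemma Filament.interior_carrier_eq_empty (hK : K.Filament) : interior K.carrier = ∅ := by
  obtain ⟨U, -, hKU, hint⟩ := hK.exists_isOpen_forall_interior_eq_empty
  exact hint K le_rfl hKU

lemma Filament.not_ample (hK : K.Filament) : ¬ K.Ample := by
  obtain ⟨U, hU, hKU, hint⟩ := hK.exists_isOpen_forall_interior_eq_empty
  intro hA
  obtain ⟨L, hKL, hLU⟩ := hA U hU hKU
  rw [hint L (hKL.trans interior_subset) hLU] at hKL
  exact K.isConnected_carrier.nonempty.not_subset_empty hKL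

/-- Boundary bumping: a continuum that starts outside `T` and runs up to a small open set inside
`T`, without entering it, would contradict terminality. -/
theorem Terminal.interior_carrier_eq_empty [CompactSpace X] [ConnectedSpace X] (hT : T.Terminal)
    (hne : T.carrier ≠ univ) : interior T.carrier = ∅ := by
  by_contra hint
  obtain ⟨x, hx⟩ := nonempty_iff_ne_empty.2 hint
  obtain ⟨w, hw⟩ := (ne_univ_iff_exists_notMem T.carrier).1 hne
  obtain ⟨V, hV, hxV, hVT⟩ := normal_exists_closure_subset isClosed_singleton isOpen_interior
    (singleton_subset_iff.2 hx)
  have hVT : closure V ⊆ T.carrier := hVT.trans interior_subset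
  obtain ⟨K, -, hwK, hKV, hK⟩ := (ofSet univ isCompact_univ
    isConnected_univ).exists_le_disjoint_inter_closure_nonempty hV ⟨x, mem_univ x, hxV rfl⟩
    ⟨mem_univ w, fun h => hw (hVT (subset_closure h))⟩
  rcases hT K (hK.mono fun y hy => ⟨hVT hy.2, hy.1⟩) with hTK | hKT
  · exact disjoint_left.1 hKV (hTK (interior_subset hx)) (hxV rfl)
  · exact hw (hKT hwK)

theorem Terminal.filament_of_lt [CompactSpace X] [ConnectedSpace X] (hT : T.Terminal)
    (hne : T.carrier ≠ univ) (hKT : K < T) : K.Filament := by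
  obtain ⟨y, hyT, hyK⟩ := exists_of_ssubset hKT
  obtain ⟨U, hU, hKU, hUy⟩ := normal_exists_closure_subset K.isCompact_carrier.isClosed
    isOpen_compl_singleton (subset_compl_singleton_iff.2 hyK)
  refine ⟨U, hU, hKU, fun x hx => ?_⟩
  have hxC : x ∈ connectedComponentIn U x := mem_connectedComponentIn (hKU hx)
  let C : Hyperspace X := ofSet (closure (connectedComponentIn U x)) isClosed_closure.isCompact
    (isConnected_connectedComponentIn_iff.2 (hKU hx)).closure
  have hyC : y ∉ C.carrier := fun h =>
    hUy (closure_mono (connectedComponentIn_subset U x) h) rfl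
  have hCT : C.carrier ⊆ T.carrier := (hT C ⟨x, hKT.le hx, subset_closure hxC⟩).resolve_left
    fun h => hyC (h hyT)
  exact subset_eq_empty (interior_mono (subset_closure.trans hCT))
    (hT.interior_carrier_eq_empty hne)

end Hyperspace

section Fibers

variable {X Y : Type*} [MetricSpace X] [TopologicalSpace Y] [T2Space Y] {p : X → Y}

lemma Hyperspace.ample_of_carrier_eq_preimage_singleton [CompactSpace X] [LocallyConnectedSpace Y]
    (hp : Continuous p) (hfib : ∀ y, IsConnected (p ⁻¹' {y})) {K : Hyperspace X} {y : Y}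
    (hK : K.carrier = p ⁻¹' {y}) : K.Ample := by
  have hsurj : Function.Surjective p := fun y => (hfib y).nonempty
  have := hsurj.compactSpace hp
  intro U hU hKU
  have hV : (p '' Uᶜ)ᶜ ∈ 𝓝 y := by
    refine (hp.isClosedMap _ hU.isClosed_compl).isOpen_compl.mem_nhds ?_
    rintro ⟨x, hxU, hxy⟩
    exact hxU (hKU (hK ▸ hxy))
  obtain ⟨T, hT, hTclosed, hTV⟩ := exists_mem_nhds_isClosed_subset hV
  obtain ⟨W, hWT, hWo, hyW, hWc⟩ :=
    locallyConnectedSpace_iff_subsets_isOpen_isConnected.1 inferInstance y T hT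
  have hconn : IsConnected (p ⁻¹' closure W) :=
    (hp.isClosedMap.isQuotientMap hp hsurj).isCoinducing.isConnected_preimage_of_isClosed hfib
      isClosed_closure hWc.closure
  refine ⟨ofSet _ (isClosed_closure.preimage hp).isCompact hconn, ?_, fun x hx => ?_⟩
  · have hW : p ⁻¹' W ⊆ p ⁻¹' closure W := preimage_mono subset_closure
    refine subset_trans ?_ (interior_maximal hW (hWo.preimage hp))
    exact hK.trans_subset (preimage_mono (singleton_subset_iff.2 hyW))
  · by_contra hxU
    exact hTV (closure_minimal hWT hTclosed hx) ⟨x, hxU, rfl⟩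

lemma isClosed_setOf_exists_carrier_subset_preimage_singleton (hp : Continuous p) :
    IsClosed {K : Hyperspace X | ∃ y, K.carrier ⊆ p ⁻¹' {y}} := by
  have hmap : Continuous fun K : Hyperspace X => NonemptyCompacts.map p hp K.1 :=
    hp.nonemptyCompacts_map.comp continuous_subtype_val
  convert! NonemptyCompacts.isClosedEmbedding_singleton.isClosed_range.preimage hmap using 1
  ext K
  refine exists_congr fun y => ?_
  rw [← image_subset_iff, (K.isConnected_carrier.nonempty.image p).subset_singleton_iff, eq_comm,
    NonemptyCompacts.ext_iff]
  rfl

end Fibers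

/-- The continuous map `p` decomposes `X` into terminal subcontinua; `P y` is the fibre over `y` as
a point of the hyperspace. Surjectivity of `p` is automatic, subcontinua being nonempty. -/
structure IsTerminalDecomposition {X Y : Type*} [MetricSpace X] [TopologicalSpace Y] (p : X → Y)
    (P : Y → Hyperspace X) : Prop where
  continuous : Continuous p
  carrier_eq : ∀ y, (P y).carrier = p ⁻¹' {y}
  terminal : ∀ y, (P y).Terminal

namespace IsTerminalDecomposition

open Hyperspace

variable {X Y : Type*} [MetricSpace X] [TopologicalSpace Y] {p : X → Y} {P : Y → Hyperspace X}

lemma mem_carrier_iff (h : IsTerminalDecomposition p P) {x : X} {y : Y} :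
    x ∈ (P y).carrier ↔ p x = y := by
  rw [h.carrier_eq, mem_preimage, mem_singleton_iff]

lemma surjective (h : IsTerminalDecomposition p P) : Function.Surjective p := fun y =>
  (P y).isConnected_carrier.nonempty.imp fun _ => h.mem_carrier_iff.1

lemma le_or_le (h : IsTerminalDecomposition p P) {K : Hyperspace X} {x : X} (hx : x ∈ K.carrier) :
    P (p x) ≤ K ∨ K ≤ P (p x) :=
  h.terminal (p x) K ⟨x, h.mem_carrier_iff.2 rfl, hx⟩

lemma carrier_ne_univ [Nontrivial Y] (h : IsTerminalDecomposition p P) (y : Y) :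
    (P y).carrier ≠ univ := by
  obtain ⟨z, hz⟩ := exists_ne y
  obtain ⟨x, rfl⟩ := h.surjective z
  exact (ne_univ_iff_exists_notMem _).2 ⟨x, fun hx => hz (h.mem_carrier_iff.1 hx)⟩

lemma exists_le_or_preimage_image_subset (h : IsTerminalDecomposition p P) (K : Hyperspace X) :
    (∃ y, K ≤ P y) ∨ p ⁻¹' (p '' K.carrier) ⊆ K.carrier := by
  refine or_iff_not_imp_left.2 fun hK => ?_
  rintro x ⟨y, hy, hxy⟩
  have hPK : P (p y) ≤ K := (h.le_or_le hy).resolve_right fun hle => hK ⟨_, hle⟩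
  exact hPK (h.mem_carrier_iff.2 hxy.symm)

/-- Otherwise `K` would be saturated, by terminality of the fibres, and contain the preimage of the
interior of its image. -/
theorem exists_le_of_filament (h : IsTerminalDecomposition p P)
    (hY : ∀ S : Set Y, IsPreconnected S → S.Nontrivial → (interior S).Nonempty)
    {K : Hyperspace X} (hK : K.Filament) : ∃ y, K ≤ P y := by
  by_contra hKP
  have hsat := (h.exists_le_or_preimage_image_subset K).resolve_left hKP
  have hnt : (p '' K.carrier).Nontrivial := by
    by_contra hs
    obtain ⟨x, hx⟩ := K.isConnected_carrier.nonempty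
    refine hKP ⟨p x, fun y hy => h.mem_carrier_iff.2 ?_⟩
    exact not_nontrivial_iff.1 hs (mem_image_of_mem p hy) (mem_image_of_mem p hx)
  have himage := hY _ (K.isConnected_carrier.isPreconnected.image p h.continuous.continuousOn) hnt
  refine (himage.preimage h.surjective).not_subset_empty ?_
  rw [← hK.interior_carrier_eq_empty]
  exact interior_maximal ((preimage_mono interior_subset).trans hsat)
    (isOpen_interior.preimage h.continuous)

theorem planckBoundary_eq_range [CompactSpace X] [ConnectedSpace X] [T2Space Y]
    [LocallyConnectedSpace Y] [Nontrivial Y] (h : IsTerminalDecomposition p P)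
    (hY : ∀ S : Set Y, IsPreconnected S → S.Nontrivial → (interior S).Nonempty)
    (hnt : ∀ y, (P y).carrier.Nontrivial) (hind : ∀ y, ¬ (P y).Decomposable) :
    planckBoundary X = range P := by
  have hfilament {K : Hyperspace X} {y : Y} (hK : K < P y) : K.Filament :=
    (h.terminal y).filament_of_lt (h.carrier_ne_univ y) hK
  apply Subset.antisymm
  · rintro K ⟨hample, hclosure⟩
    obtain ⟨y, hy⟩ : ∃ y, K.carrier ⊆ p ⁻¹' {y} := by
      refine closure_minimal (fun L hL => ?_)
        (isClosed_setOf_exists_carrier_subset_preimage_singleton h.continuous) hclosure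
      obtain ⟨y, hy⟩ := h.exists_le_of_filament hY hL
      exact ⟨y, h.carrier_eq y ▸ hy⟩
    have hKP : K ≤ P y := fun x hx => h.mem_carrier_iff.2 (hy hx)
    exact ⟨y, (eq_of_le_of_not_lt hKP fun hlt => (hfilament hlt).not_ample hample).symm⟩
  · rintro _ ⟨y, rfl⟩
    exact ⟨ample_of_carrier_eq_preimage_singleton h.continuous
      (fun z => h.carrier_eq z ▸ (P z).isConnected_carrier) (h.carrier_eq y),
      closure_mono (fun _ => hfilament) (mem_closure_Iio (hnt y) (hind y))⟩

theorem preimage_singleton_eq_range {α : Type*} [Preorder α]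
    (h : IsTerminalDecomposition p P) {f : Hyperspace X → α} (hf : StrictMono f) {l : α}
    (hl : ∀ y, f (P y) = l) : f ⁻¹' {l} = range P := by
  apply Subset.antisymm
  · intro K (hK : f K = l)
    obtain ⟨x, hx⟩ := K.isConnected_carrier.nonempty
    have hfx : f (P (p x)) = f K := (hl _).trans hK.symm
    refine ⟨p x, ?_⟩
    rcases h.le_or_le hx with hle | hle
    · exact eq_of_le_of_not_lt hle fun hlt => (hf hlt).ne hfx
    · exact (eq_of_le_of_not_lt hle fun hlt => (hf hlt).ne hfx.symm).symm
  · rintro _ ⟨y, rfl⟩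
    exact hl y

end IsTerminalDecomposition

lemma IsWhitneyMap.strictMono_whitneyRestrict {X : Type*} [MetricSpace X]
    {μ : NonemptyCompacts X → ℝ} (hμ : IsWhitneyMap μ) : StrictMono (whitneyRestrict μ) :=
  fun K L hKL => hμ.strictMono K.1 L.1 hKL

namespace IsCircleOfPseudoArcs

variable {X : Type*} [MetricSpace X] {p : X → Circle}

lemma isTerminalDecomposition (hp : IsCircleOfPseudoArcs p) :
    IsTerminalDecomposition p hp.fiber where
  continuous := hp.continuous
  carrier_eq _ := rfl
  terminal z := hp.terminal z (hp.fiber z) rfl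

lemma nontrivial_carrier_fiber (hp : IsCircleOfPseudoArcs p) (z : Circle) :
    (hp.fiber z).carrier.Nontrivial :=
  nontrivial_coe_sort.1 (hp.pseudoArc z).nondegenerate

lemma not_decomposable_fiber (hp : IsCircleOfPseudoArcs p) (z : Circle) :
    ¬ (hp.fiber z).Decomposable := fun h =>
  (hp.pseudoArc z).hereditarilyIndecomposable _ (h.restrict subset_rfl)

end IsCircleOfPseudoArcs

theorem mainTheorem5_general {X Y α : Type*} [MetricSpace X] [CompactSpace X] [ConnectedSpace X]
    [TopologicalSpace Y] [T2Space Y] [LocallyConnectedSpace Y] [Nontrivial Y] [Preorder α]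
    (hY : ∀ S : Set Y, IsPreconnected S → S.Nontrivial → (interior S).Nonempty)
    {p : X → Y} {P : Y → Hyperspace X} (hP : IsTerminalDecomposition p P)
    (hnt : ∀ y, (P y).carrier.Nontrivial) (hind : ∀ y, ¬ (P y).Decomposable)
    {f : Hyperspace X → α} (hf : StrictMono f) {l : α} (hl : ∀ y, f (P y) = l) :
    planckBoundary X = f ⁻¹' {l} :=
  (hP.planckBoundary_eq_range hY hnt hind).trans (hP.preimage_singleton_eq_range hf hl).symm

theorem mainTheorem5 {X : Type*} [MetricSpace X] [CompactSpace X] [ConnectedSpace X]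
    (p : X → Circle) (hp : IsCircleOfPseudoArcs p)
    (μ : TopologicalSpace.NonemptyCompacts X → ℝ) (hμ : IsWhitneyMap μ)
    (l : ℝ) (hl : ∀ z : Circle, whitneyRestrict μ (hp.fiber z) = l) :
    planckBoundary X = whitneyRestrict μ ⁻¹' {l} :=
  mainTheorem5_general (fun _ => interior_nonempty_of_isPreconnected_circle)
    hp.isTerminalDecomposition hp.nontrivial_carrier_fiber hp.not_decomposable_fiber
    hμ.strictMono_whitneyRestrict hl
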